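/- Fix integers $r,m\ge 2$. For $j_0\in\{-2r,-r\}$ let $(P_{j_0,k}(c))_{k\ge -2r}$ be the polynomials in $c$ (with complex coefficients) determined by the initial values $P_{j_0,j_0}=1$ and $P_{j_0,j}=0$ for $j\in\{-2r,\dots,-1\}\setminus\{j_0\}$, and by the recursion $$(2r+m+km)\,P_{j_0,k}=2c\,\bigl(r+(1+k-r)m\bigr)P_{j_0,k-r}-\bigl(k-(2r-1)\bigr)m\,P_{j_0,k-2r}\qquad(k\ge 0).$$ (i) For every integer $n\ge 0$ the polynomial $P_n:=P_{-2r,\,n-2r}(c)$, that is, the coefficient of $z^n$ in $\sum_{k\ge-2r}P_{-2r,k}(c)z^{k+2r}$, satisfies $$(c^2-1)^2m^2r^4P_n''''+10c(c^2-1)m^2r^4P_n'''+\bigl[X^{(1)}_nc^2+Y^{(1)}_n\bigr]P_n''+Z^{(1)}_n\,c\,P_n'+W^{(1)}_nP_n=0,$$ where primes denote derivatives in $c$ and $$\begin{aligned} W^{(1)}_n&=n(n-2r)\bigl(m(n-2r+2)+2r\bigr)\bigl(m(n-4r+2)+2r\bigr),\\ X^{(1)}_n&=r^2\bigl(-2m^2((n+2)n+2)+4mr(m(2n+3)-n-2)+r^2(3m(5m+4)-4)\bigr),\\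 Y^{(1)}_n&=r^2\bigl(2m^2((n+2)n+2)-4mr(m(2n+3)-n-2)-16mr^2\bigr),\\ Z^{(1)}_n&=-3r^2\bigl(m^2(-8nr+2(n+2)n+5r^2-12r+4)+4mr(n-3r+2)+4r^2\bigr). \end{aligned}$$ (ii) For every integer $n\ge 0$ the polynomial $P_n:=P_{-r,\,n-2r}(c)$, that is, the coefficient of $z^n$ in $\sum_{k\ge-2r}P_{-r,k}(c)z^{k+2r}$, satisfies $$(c^2-1)^2m^2r^4P_n''''+10c(c^2-1)m^2r^4P_n'''+\bigl[X^{(2)}_nc^2+Y^{(2)}_n\bigr]P_n''+Z^{(2)}_n\,c\,P_n'+W^{(2)}_nP_n=0,$$ where, with $\Delta=r^2(r-2)m(2mn-7mr+2m+4r)$, $$\begin{aligned} W^{(2)}_n&=(n^2-r^2)\bigl(m(n-5r+2)+2r\bigr)\bigl(m(n-3r+2)+2r\bigr),\\ X^{(2)}_n&=-2r^2\bigl(m^2((n-r)(n-2r)-10r^2)+2mr(n-3r)+2r^2\bigr)+\Delta,\\ Y^{(2)}_n&=2r^2\bigl(m^2((n-r)(n-2r)-(2r^2+r))+2mr(n-4r)\bigr)-r^2(r-2)m\bigl(2mn-6mr+2m+4r\bigr),\\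 Z^{(2)}_n&=-3r^2\bigl(2m^2(n-r)(n-2r)+4mr(n-3r)+4r^2\bigr)+3\Delta. \end{aligned}$$ -/

import Mathlib

open Polynomial

noncomputable section

/-- The family attached to the initial condition `j₀`, indexed by the exponent `i` of `z` in the
generating function: `superellipticAux r m j₀ i` is `P_{j₀, i - 2r}(c)`, with `c` the variable `X`.
The initial values are those with `i < 2r`, and for `i = k + 2r ≥ 2r` the value is the solution
of the recursion
`(2r + m + k m) P_k = 2 c (r + (1 + k - r) m) P_{k-r} - (k - (2r - 1)) m P_{k-2r}`.
The disjunct `r = 0` only serves termination. -/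
def superellipticAux (r m : ℕ) (j₀ : ℤ) (i : ℕ) : ℂ[X] :=
  if h : r = 0 ∨ i < 2 * r then
    if (i : ℤ) - 2 * r = j₀ then 1 else 0
  else
    let k : ℂ := (i : ℂ) - 2 * r
    C ((2 * r + m + k * m)⁻¹) *
      (2 * X * C (r + (1 + k - r) * m) * superellipticAux r m j₀ (i - r)
        - C ((k - (2 * r - 1)) * m) * superellipticAux r m j₀ (i - 2 * r))
  termination_by i
  decreasing_by all_goals omega

/-- The polynomial `P_{j₀, k}(c)`, for an integer index `k ≥ -2r`. -/
def superellipticPoly (r m : ℕ) (j₀ k : ℤ) : ℂ[X] :=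
  superellipticAux r m j₀ (k + 2 * r).toNat

/-- The initial values: `P_{j₀} = 1` and `P_j = 0` for the other `j` in `{-2r, …, -1}`. -/
theorem superellipticPoly_initial (r m : ℕ) (j₀ j : ℤ) (h1 : -2 * (r : ℤ) ≤ j) (h2 : j ≤ -1) :
    superellipticPoly r m j₀ j = if j = j₀ then 1 else 0 := by
  have hi : (((j + 2 * r).toNat : ℕ) : ℤ) = j + 2 * r := Int.toNat_of_nonneg (by omega)
  unfold superellipticPoly superellipticAux
  rw [dif_pos (Or.inr (by omega)), hi]
  simp

/-- The three-term recursion, for every `k ≥ 0`. -/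
theorem superellipticPoly_recursion (r m : ℕ) (hr : 1 ≤ r) (j₀ k : ℤ) (hk : 0 ≤ k) :
    C (2 * (r : ℂ) + m + k * m) * superellipticPoly r m j₀ k =
      2 * X * C ((r : ℂ) + (1 + k - r) * m) * superellipticPoly r m j₀ (k - r)
        - C (((k : ℂ) - (2 * r - 1)) * m) * superellipticPoly r m j₀ (k - 2 * r) := by
  obtain ⟨k, rfl⟩ := Int.eq_ofNat_of_zero_le hk
  have e0 : ((k : ℤ) + 2 * r).toNat = k + 2 * r := by omega
  have e1 : ((k : ℤ) - r + 2 * r).toNat = k + 2 * r - r := by omega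
  have e2 : ((k : ℤ) - 2 * r + 2 * r).toNat = k + 2 * r - 2 * r := by omega
  have hne : (2 * (r : ℂ) + m + k * m) ≠ 0 := by
    have : 2 * r + m + k * m ≠ 0 := by positivity
    exact_mod_cast this
  unfold superellipticPoly
  rw [e0, e1, e2]
  conv_lhs => rw [superellipticAux]
  rw [dif_neg (by omega)]
  have ek : ((k + 2 * r : ℕ) : ℂ) - 2 * r = k := by push_cast; ring
  simp only [ek, Int.cast_natCast]
  rw [← mul_assoc, ← C_mul, mul_inv_cancel₀ hne, C_1, one_mul]

/-- The left-hand side of the differential equation, as an operator on polynomials `p(c)`: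
`(c²-1)² m² r⁴ p'''' + 10 c (c²-1) m² r⁴ p''' + (x c² + y) p'' + z c p' + w p`. -/
def fourthOrderOp (r m x y z w : ℂ) (p : ℂ[X]) : ℂ[X] :=
  (X ^ 2 - 1) ^ 2 * C (m ^ 2 * r ^ 4) * derivative^[4] p
    + 10 * X * (X ^ 2 - 1) * C (m ^ 2 * r ^ 4) * derivative^[3] p
    + (C x * X ^ 2 + C y) * derivative^[2] p
    + C z * X * derivative p
    + C w * p

def W₁ (r m n : ℂ) : ℂ :=
  n * (n - 2 * r) * (m * (n - 2 * r + 2) + 2 * r) * (m * (n - 4 * r + 2) + 2 * r)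

def X₁ (r m n : ℂ) : ℂ :=
  r ^ 2 * (-2 * m ^ 2 * ((n + 2) * n + 2) + 4 * m * r * (m * (2 * n + 3) - n - 2)
    + r ^ 2 * (3 * m * (5 * m + 4) - 4))

def Y₁ (r m n : ℂ) : ℂ :=
  r ^ 2 * (2 * m ^ 2 * ((n + 2) * n + 2) - 4 * m * r * (m * (2 * n + 3) - n - 2)
    - 16 * m * r ^ 2)

def Z₁ (r m n : ℂ) : ℂ :=
  -3 * r ^ 2 * (m ^ 2 * (-8 * n * r + 2 * (n + 2) * n + 5 * r ^ 2 - 12 * r + 4)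
    + 4 * m * r * (n - 3 * r + 2) + 4 * r ^ 2)

/-- The correction term `Δ`. -/
def corr (r m n : ℂ) : ℂ :=
  r ^ 2 * (r - 2) * m * (2 * m * n - 7 * m * r + 2 * m + 4 * r)

def W₂ (r m n : ℂ) : ℂ :=
  (n ^ 2 - r ^ 2) * (m * (n - 5 * r + 2) + 2 * r) * (m * (n - 3 * r + 2) + 2 * r)

def X₂ (r m n : ℂ) : ℂ :=
  -2 * r ^ 2 * (m ^ 2 * ((n - r) * (n - 2 * r) - 10 * r ^ 2) + 2 * m * r * (n - 3 * r)
    + 2 * r ^ 2) + corr r m n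

def Y₂ (r m n : ℂ) : ℂ :=
  2 * r ^ 2 * (m ^ 2 * ((n - r) * (n - 2 * r) - (2 * r ^ 2 + r)) + 2 * m * r * (n - 4 * r))
    - r ^ 2 * (r - 2) * m * (2 * m * n - 6 * m * r + 2 * m + 4 * r)

def Z₂ (r m n : ℂ) : ℂ :=
  -3 * r ^ 2 * (2 * m ^ 2 * (n - r) * (n - 2 * r) + 4 * m * r * (n - 3 * r) + 4 * r ^ 2)
    + 3 * corr r m n

end

/-!
Only the exponents `n = r l` matter: the recursion steps by `r`, so the other polynomials vanish.
Along them, with `a = 2/m + 1/r - 1` and `b = 1/r - 2`, the recursion is that of the associated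
Gegenbauer polynomials
`(a + l + 1) f (l+2) = (2l + a + b + 1) X f (l+1) - (b + l) f l`.
Heuristically, `f l` is a combination `∑ yₗ v` in which `yₗ` runs through the Gegenbauer functions
of degree `a + l - 1`, while the coefficients `v` depend on the initial values but not on `l`.
The classical ladder relations give `(1 - X²) yₗ'` in terms of `yₗ, yₗ₊₁`, so they can be subtracted
from `(1 - X²) (f l)'`, which leaves `∑ (1 - X²) yₗ v'`. This is the operator `ladder a b`; it maps
solutions of the recursion to solutions (`SolvesGegenbauer.map_ladder`).

A solution is determined by its first two terms, so the second-order equation for `v`, which reads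
`ladder (ladder f) = (a - b) X ladder f + μ (1 - X²) f`, need only be verified for `l = 0, 1`. It
holds with `μ = -b (a + 1)` for the initial values `1, 0` and with `μ = a (1 - b)` for `0, 1`.
Since `yₗ` and `v` both satisfy second-order equations, their products satisfy one of order four;
this elimination is `fourth_order_of_first_order_system`. With `n = r l`, the
coefficients agree up to the factor `m² r⁴`.
-/

open Polynomial

noncomputable section

/-! ### Associated Gegenbauer recursions -/

/-- The three-term recursion of the associated Gegenbauer polynomials, normalized so that no
division occurs. -/
def SolvesGegenbauer (a b : ℂ) (f : ℕ → ℂ[X]) : Prop :=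
  ∀ l : ℕ, (C a + (l : ℂ[X]) + 1) * f (l + 2) =
    (2 * (l : ℂ[X]) + C a + C b + 1) * X * f (l + 1) - (C b + (l : ℂ[X])) * f l

/-- The defect of a sequence in the Gegenbauer ladder relation
`(1 - X²) y l' = (b + l) X y l - (a + l) y (l + 1)`. -/
def ladder (a b : ℂ) (f : ℕ → ℂ[X]) (l : ℕ) : ℂ[X] :=
  (1 - X ^ 2) * derivative (f l) - (C b + (l : ℂ[X])) * X * f l
    + (C a + (l : ℂ[X])) * f (l + 1)

namespace SolvesGegenbauer

variable {a b : ℂ} {f : ℕ → ℂ[X]}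

/-- On solutions of the recursion the defect is also that of the other ladder relation, which
steps down. -/
theorem ladder_succ (hf : SolvesGegenbauer a b f) (l : ℕ) :
    ladder a b f (l + 1) = (1 - X ^ 2) * derivative (f (l + 1))
      + (C a + (l : ℂ[X])) * X * f (l + 1) - (C b + (l : ℂ[X])) * f l := by
  have h := hf l
  simp only [ladder]
  push_cast
  linear_combination h

theorem map_ladder (hf : SolvesGegenbauer a b f) : SolvesGegenbauer a b (ladder a b f) := by
  intro l
  have h := hf l
  have hd := congrArg derivative h
  simp only [derivative_mul, derivative_add, derivative_sub, derivative_C, derivative_natCast,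
    derivative_X, derivative_one, derivative_ofNat] at hd
  rw [hf.ladder_succ l, hf.ladder_succ (l + 1), ladder]
  push_cast
  linear_combination (1 - X ^ 2) * hd + (C a + (l : ℂ[X]) + 1) * X * h

theorem sub_mul_sub_mul {g h : ℕ → ℂ[X]} (hf : SolvesGegenbauer a b f)
    (hg : SolvesGegenbauer a b g) (hh : SolvesGegenbauer a b h) (s t : ℂ[X]) :
    SolvesGegenbauer a b (fun l => f l - s * g l - t * h l) := by
  intro l
  linear_combination hf l - s * hg l - t * hh l

theorem eq_zero (hf : SolvesGegenbauer a b f) (ha : ∀ l : ℕ, a + l + 1 ≠ 0)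
    (h0 : f 0 = 0) (h1 : f 1 = 0) (l : ℕ) : f l = 0 := by
  induction l using Nat.twoStepInduction with
  | zero => exact h0
  | one => exact h1
  | more l ih0 ih1 =>
    have h := hf l
    rw [ih0, ih1, mul_zero, mul_zero, sub_zero] at h
    refine (mul_eq_zero.mp h).resolve_left ?_
    have e : C a + (l : ℂ[X]) + 1 = C (a + l + 1) := by simp
    rw [e]
    exact C_ne_zero.mpr (ha l)

/-- The iterated ladder relation holds as soon as it holds for the first two terms. -/
theorem ladder_ladder (hf : SolvesGegenbauer a b f) (ha : ∀ l : ℕ, a + l + 1 ≠ 0) (s t : ℂ[X])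
    (h0 : ladder a b (ladder a b f) 0 = s * ladder a b f 0 + t * f 0)
    (h1 : ladder a b (ladder a b f) 1 = s * ladder a b f 1 + t * f 1)
    (l : ℕ) :
    ladder a b (ladder a b f) l = s * ladder a b f l + t * f l := by
  have h := (hf.map_ladder.map_ladder.sub_mul_sub_mul hf.map_ladder hf s t).eq_zero ha
    (by linear_combination h0) (by linear_combination h1) l
  linear_combination h

end SolvesGegenbauer

/-! ### Elimination to a scalar equation of order four -/

theorem one_sub_X_sq_ne_zero : (1 - X ^ 2 : ℂ[X]) ≠ 0 := by
  intro h
  have := congrArg (eval 0) h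
  simp at this

/-- Elimination of `q`, `r`, `u` from a first-order system. For `p = y v` the remaining unknowns are
`r = (1 - X²) y v'` and the analogues `q`, `u` of `p`, `r` for the next Gegenbauer function; the
combination `2 r - (1 - X²) p' = (1 - X²) (y v' - y' v)` has a simple derivative. -/
theorem fourth_order_of_first_order_system (A B μ : ℂ) {p q r u : ℂ[X]}
    (hp : (1 - X ^ 2) * derivative p = r + C B * X * p - C A * q)
    (hq : (1 - X ^ 2) * derivative q = u - C A * X * q + C B * p)
    (hr : (1 - X ^ 2) * derivative r = C A * X * r - C A * u + C μ * (1 - X ^ 2) * p)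
    (hu : (1 - X ^ 2) * derivative u = - (C B * X * u) + C B * r + C μ * (1 - X ^ 2) * q) :
    (X ^ 2 - 1) ^ 2 * derivative^[4] p + 10 * X * (X ^ 2 - 1) * derivative^[3] p
      + (C (24 + 2 * (μ - (A - 1) * B) - (A - B) ^ 2) * X ^ 2
          - C (8 + 2 * (μ - (A - 1) * B))) * derivative^[2] p
      + C (12 + 6 * (μ - (A - 1) * B) - 3 * (A - B) ^ 2) * X * derivative p
      + C ((μ + (A - 1) * B) ^ 2 - 2 * (A - B) * (μ + (A - 1) * B) + 2 * (μ - (A - 1) * B)) * p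
      = 0 := by
  have hw := one_sub_X_sq_ne_zero
  have hE := congrArg derivative hp
  -- The derivative of `2 r - (1 - X²) p'` involves only `p` and `p'`.
  have hG : 2 * derivative r - derivative ((1 - X ^ 2) * derivative p)
      = (C A - C B) * X * derivative p + (C μ + (C A - 1) * C B) * p := by
    apply mul_left_cancel₀ hw
    simp only [derivative_mul, derivative_add, derivative_sub, derivative_C, derivative_pow,
      derivative_X, derivative_one, map_ofNat, Nat.cast_ofNat] at hE ⊢
    linear_combination -(1 - X ^ 2) * hE + hr + C A * hq - C A * X * hp
  -- Only `u` remains beyond what `hp` eliminates; this equation serves to eliminate it from the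
  -- derivative of the same equation.
  have hp₂ : (1 - X ^ 2) * ((1 - X ^ 2) * derivative (derivative p) - 2 * X * derivative p)
      = C A * X * r - 2 * C A * u + (C μ + C B) * (1 - X ^ 2) * p
        + C B * X * ((1 - X ^ 2) * derivative p) + C A ^ 2 * X * q - C A * C B * p := by
    simp only [derivative_mul, derivative_add, derivative_sub, derivative_C, derivative_pow,
      derivative_X, derivative_one, map_ofNat, Nat.cast_ofNat] at hE
    linear_combination (1 - X ^ 2) * hE + hr - C A * hq
  have hE₂ := congrArg derivative hp₂
  simp only [derivative_mul, derivative_add, derivative_sub, derivative_C, derivative_pow,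
    derivative_X, derivative_one, derivative_ofNat, map_ofNat, Nat.cast_ofNat] at hE₂
  have hp₃ : (1 - X ^ 2) ^ 2 * derivative (derivative (derivative p))
      = 6 * X * (1 - X ^ 2) * derivative (derivative p)
        + ((2 + 2 * (C μ - (C A - 1) * C B)) * (1 - X ^ 2) + ((C A - C B) ^ 2 - 4) * X ^ 2)
          * derivative p
        + (C A - C B - (C μ + (C A - 1) * C B)) * (2 * r - (1 - X ^ 2) * derivative p)
        + ((C A - C B) * (C μ + (C A - 1) * C B) - 2 * (C μ - (C A - 1) * C B)) * X * p := by
    apply mul_left_cancel₀ hw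
    linear_combination (1 - X ^ 2) * hE₂ + C B * X * hp₂ + C A * X * hr - 2 * C A * hu
      + C A ^ 2 * X * hq
      + (C A * (1 - X ^ 2) - 2 * C μ * (1 - X ^ 2) - C A ^ 2 * X ^ 2 + C A * C B * X ^ 2) * hp
  have hE₃ := congrArg derivative hp₃
  simp only [derivative_mul, derivative_add, derivative_sub, derivative_C, derivative_pow,
    derivative_X, derivative_one, derivative_ofNat, Nat.cast_ofNat, map_ofNat] at hE₃ hG
  simp only [Function.iterate_succ, Function.iterate_zero, Function.comp_apply, id_eq,
    map_add, map_sub, map_mul, map_pow, map_one, map_ofNat]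
  linear_combination hE₃ + (C A - C B - (C μ + (C A - 1) * C B)) * hG

/-! ### The scalar equation for the two fundamental solutions -/

namespace SolvesGegenbauer

variable {a b : ℂ} {f : ℕ → ℂ[X]}

/-- The equation of order four satisfied by `f l`, given the equation of order two satisfied by the
coefficients that do not depend on `l`. -/
theorem fourth_order (hf : SolvesGegenbauer a b f) (μ : ℂ)
    (h : ∀ l, ladder a b (ladder a b f) l =
      (C a - C b) * X * ladder a b f l + C μ * (1 - X ^ 2) * f l) (l : ℕ) :
    (X ^ 2 - 1) ^ 2 * derivative^[4] (f l) + 10 * X * (X ^ 2 - 1) * derivative^[3] (f l)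
      + (C (24 + 2 * (μ - (a + l - 1) * (b + l)) - (a - b) ^ 2) * X ^ 2
          - C (8 + 2 * (μ - (a + l - 1) * (b + l)))) * derivative^[2] (f l)
      + C (12 + 6 * (μ - (a + l - 1) * (b + l)) - 3 * (a - b) ^ 2) * X * derivative (f l)
      + C ((μ + (a + l - 1) * (b + l)) ^ 2 - 2 * (a - b) * (μ + (a + l - 1) * (b + l))
          + 2 * (μ - (a + l - 1) * (b + l))) * f l = 0 := by
  have hp := ladder.eq_1 a b f l
  have hr := h l
  have hu := h (l + 1)
  rw [hf.map_ladder.ladder_succ l] at hu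
  have hq := hf.ladder_succ l
  rw [ladder] at hr
  have key := fourth_order_of_first_order_system (a + l) (b + l) μ
    (p := f l) (q := f (l + 1)) (r := ladder a b f l) (u := ladder a b f (l + 1))
    (by simp only [map_add, map_natCast]; linear_combination -hp)
    (by simp only [map_add, map_natCast]; linear_combination -hq)
    (by simp only [map_add, map_natCast]; linear_combination hr)
    (by simp only [map_add, map_natCast]; linear_combination hu)
  simpa only [add_sub_add_right_eq_sub] using key

/-- The solution with initial values `1, 0`. -/
theorem ladder_ladder_of_one_zero (hf : SolvesGegenbauer a b f) (ha : ∀ l : ℕ, a + l + 1 ≠ 0)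
    (h0 : f 0 = 1) (h1 : f 1 = 0) (l : ℕ) :
    ladder a b (ladder a b f) l =
      (C a - C b) * X * ladder a b f l + C (-b * (a + 1)) * (1 - X ^ 2) * f l := by
  have e0 : ladder a b f 0 = -C b * X := by simp [ladder, h0, h1]
  have e1 : ladder a b f 1 = -C b := by
    have := hf.ladder_succ 0
    simpa [h0, h1] using this
  refine hf.ladder_ladder ha _ _ ?_ ?_ l
  · rw [ladder, zero_add, e0, e1, h0]
    simp
    ring
  · rw [hf.map_ladder.ladder_succ 0, zero_add, e0, e1, h1]
    simp
    ring

/-- The solution with initial values `0, 1`. -/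
theorem ladder_ladder_of_zero_one (hf : SolvesGegenbauer a b f) (ha : ∀ l : ℕ, a + l + 1 ≠ 0)
    (h0 : f 0 = 0) (h1 : f 1 = 1) (l : ℕ) :
    ladder a b (ladder a b f) l =
      (C a - C b) * X * ladder a b f l + C (a * (1 - b)) * (1 - X ^ 2) * f l := by
  have e0 : ladder a b f 0 = C a := by simp [ladder, h0, h1]
  have e1 : ladder a b f 1 = C a * X := by
    have := hf.ladder_succ 0
    simpa [h0, h1] using this
  refine hf.ladder_ladder ha _ _ ?_ ?_ l
  · rw [ladder, zero_add, e0, e1, h0]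
    simp
    ring
  · rw [hf.map_ladder.ladder_succ 0, zero_add, e0, e1, h1]
    simp
    ring

end SolvesGegenbauer

/-! ### Superelliptic polynomials along multiples of `r` -/

theorem fourthOrderOp_zero (r m x y z w : ℂ) : fourthOrderOp r m x y z w 0 = 0 := by
  simp [fourthOrderOp]

theorem superellipticPoly_eq_zero_of_not_dvd (r m : ℕ) (hr : 1 ≤ r) (j₀ : ℤ) (hj : (r : ℤ) ∣ j₀)
    (n : ℕ) (hn : ¬ r ∣ n) : superellipticPoly r m j₀ ((n : ℤ) - 2 * r) = 0 := by
  induction n using Nat.strong_induction_on with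
  | _ n ih =>
    by_cases h : n < 2 * r
    · rw [superellipticPoly_initial r m j₀ _ (by omega) (by omega), if_neg]
      intro e
      apply hn
      have : (r : ℤ) ∣ (n : ℤ) := by
        have h2 : (n : ℤ) = j₀ + 2 * r := by omega
        rw [h2]
        exact dvd_add hj (Dvd.intro_left _ rfl)
      exact_mod_cast this
    · obtain ⟨k, rfl⟩ : ∃ k, n = k + r + r := ⟨n - 2 * r, by omega⟩
      have hrec := superellipticPoly_recursion r m hr j₀ k (by omega)
      have i1 := ih (k + r) (by omega) (by simpa using hn)
      have i2 := ih k (by omega) (by simpa using hn)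
      have c0 : ((k + r + r : ℕ) : ℤ) - 2 * r = k := by push_cast; ring
      have c1 : ((k + r : ℕ) : ℤ) - 2 * r = (k : ℤ) - r := by push_cast; ring
      rw [c1] at i1
      rw [i1, i2, mul_zero, mul_zero, sub_zero] at hrec
      rw [c0]
      refine (mul_eq_zero.mp hrec).resolve_left (C_ne_zero.mpr ?_)
      have : 2 * r + m + k * m ≠ 0 := by positivity
      exact_mod_cast this

theorem solvesGegenbauer_superellipticPoly (r m : ℕ) (hr : 1 ≤ r) (hm : 1 ≤ m) (j₀ : ℤ) :
    SolvesGegenbauer (2 / m + 1 / r - 1) (1 / r - 2)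
      (fun l => superellipticPoly r m j₀ (((r * l : ℕ) : ℤ) - 2 * r)) := by
  intro l
  have hr0 : (r : ℂ) ≠ 0 := by exact_mod_cast (by omega : r ≠ 0)
  have hm0 : (m : ℂ) ≠ 0 := by exact_mod_cast (by omega : m ≠ 0)
  have h := superellipticPoly_recursion r m hr j₀ ((r * l : ℕ) : ℤ) (by positivity)
  have c0 : ((r * (l + 2) : ℕ) : ℤ) - 2 * r = ((r * l : ℕ) : ℤ) := by push_cast; ring
  have c1 : ((r * (l + 1) : ℕ) : ℤ) - 2 * r = ((r * l : ℕ) : ℤ) - r := by push_cast; ring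
  simp only [c0, c1]
  have hc : C ((r : ℂ) * m) ≠ 0 := C_ne_zero.mpr (mul_ne_zero hr0 hm0)
  have k0 : 2 * (r : ℂ) + m + (((r * l : ℕ) : ℤ) : ℂ) * m
      = r * m * (2 / m + 1 / r - 1 + l + 1) := by
    push_cast; field_simp; ring
  have k1 : 2 * ((r : ℂ) + (1 + (((r * l : ℕ) : ℤ) : ℂ) - r) * m)
      = r * m * (2 * l + (2 / m + 1 / r - 1) + (1 / r - 2) + 1) := by
    push_cast; field_simp; ring
  have k2 : ((((r * l : ℕ) : ℤ) : ℂ) - (2 * r - 1)) * m = r * m * (1 / r - 2 + l) := by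
    push_cast; field_simp; ring
  have k1' := congrArg C k1
  rw [k0, k2] at h
  rw [C_mul] at k1'
  apply mul_left_cancel₀ hc
  simp only [map_add, map_mul, map_natCast, map_ofNat, map_one] at h k1' ⊢
  linear_combination h + X * superellipticPoly r m j₀ (((r * l : ℕ) : ℤ) - r) * k1'

/-- The equation in the normalization of `fourthOrderOp`, whose leading coefficient carries the
factor `m² r⁴`. -/
theorem fourthOrderOp_eq_zero_of_monic {r m x y z w x' y' z' w' : ℂ} {p : ℂ[X]}
    (h : (X ^ 2 - 1) ^ 2 * derivative^[4] p + 10 * X * (X ^ 2 - 1) * derivative^[3] p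
      + (C x' * X ^ 2 - C y') * derivative^[2] p + C z' * X * derivative p + C w' * p = 0)
    (hx : x = m ^ 2 * r ^ 4 * x') (hy : y = -(m ^ 2 * r ^ 4 * y'))
    (hz : z = m ^ 2 * r ^ 4 * z') (hw : w = m ^ 2 * r ^ 4 * w') :
    fourthOrderOp r m x y z w p = 0 := by
  rw [fourthOrderOp, hx, hy, hz, hw]
  simp only [C_mul, C_neg]
  linear_combination C (m ^ 2) * C (r ^ 4) * h

theorem gegenbauer_parameter_ne_zero (r m : ℕ) (hm : 1 ≤ m) (l : ℕ) :
    (2 / m + 1 / r - 1 : ℂ) + l + 1 ≠ 0 := by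
  have hpos : (0 : ℝ) < 2 / m + 1 / r + l := by
    have : (0 : ℝ) < m := by exact_mod_cast hm
    positivity
  have e : (2 / m + 1 / r - 1 : ℂ) + l + 1 = ((2 / m + 1 / r + l : ℝ) : ℂ) := by
    push_cast; ring
  rw [e]
  exact_mod_cast hpos.ne'

/-- Here the index `n ≥ 0` is the exponent of `z` in the generating function
`∑ P_{j₀, k} z ^ (k + 2r)`, so that `P_n` stands for `P_{j₀, n - 2r}`. -/
theorem theorem2p1 (r m : ℕ) (hr : 2 ≤ r) (hm : 2 ≤ m) :
    (∀ n : ℕ,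
      fourthOrderOp r m (X₁ r m n) (Y₁ r m n) (Z₁ r m n) (W₁ r m n)
        (superellipticPoly r m (-2 * (r : ℤ)) ((n : ℤ) - 2 * r)) = 0) ∧
    (∀ n : ℕ,
      fourthOrderOp r m (X₂ r m n) (Y₂ r m n) (Z₂ r m n) (W₂ r m n)
        (superellipticPoly r m (-(r : ℤ)) ((n : ℤ) - 2 * r)) = 0) := by
  have hr0 : (r : ℂ) ≠ 0 := by exact_mod_cast (by omega : r ≠ 0)
  have hm0 : (m : ℂ) ≠ 0 := by exact_mod_cast (by omega : m ≠ 0)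
  have ha := gegenbauer_parameter_ne_zero r m (by omega)
  refine ⟨fun n => ?_, fun n => ?_⟩
  · by_cases hn : r ∣ n
    · obtain ⟨l, rfl⟩ := hn
      have hf := solvesGegenbauer_superellipticPoly r m (by omega) (by omega) (-2 * (r : ℤ))
      have h := hf.fourth_order _ (hf.ladder_ladder_of_one_zero ha
        (by rw [superellipticPoly_initial _ _ _ _ (by simp) (by simp; omega), if_pos (by simp)])
        (by rw [superellipticPoly_initial _ _ _ _ (by simp) (by simp; omega),
          if_neg (by simp; omega)])) l
      apply fourthOrderOp_eq_zero_of_monic h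
      · rw [X₁]; push_cast; field_simp; ring
      · rw [Y₁]; push_cast; field_simp; ring
      · rw [Z₁]; push_cast; field_simp; ring
      · rw [W₁]; push_cast; field_simp; ring
    · rw [superellipticPoly_eq_zero_of_not_dvd r m (by omega) _ (Dvd.intro_left _ rfl) n hn,
        fourthOrderOp_zero]
  · by_cases hn : r ∣ n
    · obtain ⟨l, rfl⟩ := hn
      have hf := solvesGegenbauer_superellipticPoly r m (by omega) (by omega) (-(r : ℤ))
      have h := hf.fourth_order _ (hf.ladder_ladder_of_zero_one ha
        (by rw [superellipticPoly_initial _ _ _ _ (by simp) (by simp; omega),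
          if_neg (by simp; omega)])
        (by rw [superellipticPoly_initial _ _ _ _ (by simp) (by simp; omega),
          if_pos (by push_cast; ring)])) l
      apply fourthOrderOp_eq_zero_of_monic h
      · rw [X₂, corr]; push_cast; field_simp; ring
      · rw [Y₂]; push_cast; field_simp; ring
      · rw [Z₂, corr]; push_cast; field_simp; ring
      · rw [W₂]; push_cast; field_simp; ring
    · rw [superellipticPoly_eq_zero_of_not_dvd r m (by omega) _
        ((dvd_refl _).neg_right) n hn, fourthOrderOp_zero]

end
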